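/- Let $E$ be a countable set and $\mathcal H_0=\ell^2(E)$ the complex Hilbert space with inner product $(f,g)_0=\sum_{x\in E}\overline{f(x)}g(x)$ and unit vectors $e_x$, $x\in E$. For a bounded operator $T$ on $\mathcal H_0$ put $T(x,y)=(e_x,Te_y)_0$, and for finite $\Lambda\subset E$ let $T_\Lambda=(T(x,y))_{x,y\in\Lambda}$. Let $A$ be a bounded Hermitian positive operator on $\mathcal H_0$ satisfying (H) (i) $\ker A=\{0\}$; (ii) the completion $\mathcal H_-$ of $\mathcal H_0$ for the inner product $(f,g)_-=(f,Ag)_0$ is functionally completed, i.e. there is a Hilbert space of functions on $E$ with continuous point evaluations that contains $\mathcal H_0$, as functions on $E$, as a dense subspace with inner product $(\cdot,\cdot)_-$. Let $K=A(I+A)^{-1}$ and let $\mu$ be the determinantal point process of $K$, that is, the probability measure on the set of all subsets (configurations) of $E$, with the product $\sigma$-algebra of $\{0,1\}^E$, such that $\mu(\{\zeta:\zeta\supset X\})=\det(K(x,y))_{x,y\in X}$ for every finite $X\subset E$. Fix $x_0\in E$ and a configuration $\xi\subset E$ with $x_0\notin\xi$. For finite $\Lambda\subset E$ write $\xi_\Lambda=\xi\cap\Lambda$,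 $x_0\xi_\Lambda=\{x_0\}\cup\xi_\Lambda$ and $$\alpha_{[\Lambda]}=\frac{\mu(\{\zeta:\zeta\cap\Lambda=x_0\xi_\Lambda\})}{\mu(\{\zeta:\zeta\cap\Lambda=\xi_\Lambda\})},\qquad \alpha_\Lambda=\inf\bigl\{(e_{x_0}-f,A(e_{x_0}-f))_0: f\in\operatorname{span}\{e_x:x\in\Lambda\cap\xi\}\bigr\}.$$ Then: (1) For every finite $\Lambda\subset E$, $\mu(\{\zeta:\zeta\cap\Lambda=\xi_\Lambda\})>0$, the matrix $I_\Lambda-K_\Lambda$ is invertible, and, with $A_{[\Lambda]}=K_\Lambda(I_\Lambda-K_\Lambda)^{-1}$, $\det(A_{[\Lambda]}(x,y))_{x,y\in\xi_\Lambda}\neq0$. (2) For every finite $\Lambda\subset E$ with $x_0\in\Lambda$, $$\alpha_{[\Lambda]}=\frac{\det(A_{[\Lambda]}(x,y))_{x,y\in x_0\xi_\Lambda}}{\det(A_{[\Lambda]}(x,y))_{x,y\in\xi_\Lambda}}.$$ (3) As $\Lambda$ increases to $E$ through the finite subsets of $E$ (limit along the directed set of finite subsets), the limit $\alpha=\lim_{\Lambda\uparrow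 E}\alpha_\Lambda$ exists in $\mathbb R$, and $\lim_{\Lambda\uparrow E}\alpha_{[\Lambda]}=\alpha$. In particular, the global Papangelou intensity of $\mu$ at $x_0$ given $\xi$ exists and equals $\alpha$. -/

import Mathlib

open Filter Topology MeasureTheory
open scoped InnerProductSpace lp

universe u

noncomputable section

namespace DPP

variable {E : Type u}

open Classical in
/-- The unit vector `e_x` of `ℓ²(E)`: one at `x` and zero elsewhere. -/
def basisVec (x : E) : ℓ²(E, ℂ) :=
  lp.single 2 x (1 : ℂ)

/-- The matrix element `T(x, y) = (e_x, T e_y)₀` of a bounded operator on `ℓ²(E)`. -/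
def kernel (T : ℓ²(E, ℂ) →L[ℂ] ℓ²(E, ℂ)) (x y : E) : ℂ :=
  ⟪basisVec x, T (basisVec y)⟫_ℂ

/-- The restriction `T_Λ = P_Λ T P_Λ` to a finite set, as the matrix `(T(x, y))_{x, y ∈ Λ}`. -/
def restrict (T : ℓ²(E, ℂ) →L[ℂ] ℓ²(E, ℂ)) (Λ : Finset E) : Matrix Λ Λ ℂ :=
  Matrix.of fun x y => kernel T x y

open Classical in
/-- The principal minor `det (M(x, y))_{x, y ∈ S ∩ Λ}` of a matrix indexed by `Λ`. -/
def minor {Λ : Finset E} (M : Matrix Λ Λ ℂ) (S : Set E) : ℂ :=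
  (M.submatrix (fun x : {x : Λ // (x : E) ∈ S} => x.1)
    (fun x : {x : Λ // (x : E) ∈ S} => x.1)).det

/-- `H₋`, the completion of `ℓ²(E)` for the inner product `(f, g)₋ = (f, A g)₀`, is functionally
completed: there is a Hilbert space of functions on `E` with continuous point evaluations, which
contains `ℓ²(E)` (each vector being the same function on `E`) isometrically for `(·, ·)₋` as a
dense subspace. -/
def FunctionallyCompleted (A : ℓ²(E, ℂ) →L[ℂ] ℓ²(E, ℂ)) : Prop :=
  ∃ (H : Type u) (_ : NormedAddCommGroup H) (_ : InnerProductSpace ℂ H) (_ : CompleteSpace H)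
    (_ : RKHS ℂ H E ℂ) (j : ℓ²(E, ℂ) →ₗ[ℂ] H),
    (∀ f x, (j f) x = f x) ∧ (∀ f g, ⟪j f, j g⟫_ℂ = ⟪f, A g⟫_ℂ) ∧ DenseRange j

/-- The hypothesis (H) on the bounded operator `A`. -/
structure HypothesisH (A : ℓ²(E, ℂ) →L[ℂ] ℓ²(E, ℂ)) : Prop where
  isPositive : A.IsPositive
  ker_trivial : ∀ f, A f = 0 → f = 0
  functionallyCompleted : FunctionallyCompleted A

/-- `K = A (I + A)⁻¹`. For positive `A` the operator `I + A` is invertible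
(`isUnit_one_add`), so that `Ring.inverse` is its inverse. -/
def correlationOp (A : ℓ²(E, ℂ) →L[ℂ] ℓ²(E, ℂ)) : ℓ²(E, ℂ) →L[ℂ] ℓ²(E, ℂ) :=
  A * Ring.inverse (1 + A)

theorem isUnit_one_add {A : ℓ²(E, ℂ) →L[ℂ] ℓ²(E, ℂ)} (hA : A.IsPositive) :
    IsUnit (1 + A) := by
  have h0 : (0 : ℓ²(E, ℂ) →L[ℂ] ℓ²(E, ℂ)) ≤ A :=
    (ContinuousLinearMap.nonneg_iff_isPositive A).2 hA
  have h1 : IsStrictlyPositive (1 : ℓ²(E, ℂ) →L[ℂ] ℓ²(E, ℂ)) :=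
    IsStrictlyPositive.iff_of_unital.2 ⟨zero_le_one, isUnit_one⟩
  exact (h1.add_nonneg h0).isUnit

/-- `μ` is the determinantal point process of `K`: a probability measure on the configurations
`ξ ⊆ E` (product σ-algebra of `{0, 1}^E`) with `μ(ξ ⊇ X) = det (K(x, y))_{x, y ∈ X}` for all
finite `X ⊆ E`. -/
structure IsDPP (K : ℓ²(E, ℂ) →L[ℂ] ℓ²(E, ℂ)) (μ : Measure (Set E)) : Prop where
  isProbabilityMeasure : IsProbabilityMeasure μ
  correlation : ∀ X : Finset E,
    ((μ.real {ξ : Set E | (X : Set E) ⊆ ξ} : ℝ) : ℂ) = minor (restrict K X) X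

/-- The marginal probability `μ_Λ(S) = μ {ζ : ζ ∩ Λ = S}`. -/
def marginal (μ : Measure (Set E)) (Λ : Finset E) (S : Set E) : ℝ :=
  μ.real {ζ : Set E | ζ ∩ (Λ : Set E) = S}

/-- `α_[Λ] = μ_Λ(x₀ ξ_Λ) / μ_Λ(ξ_Λ)`. -/
def localIntensity (μ : Measure (Set E)) (x₀ : E) (ξ : Set E) (Λ : Finset E) : ℝ :=
  marginal μ Λ (insert x₀ (ξ ∩ (Λ : Set E))) / marginal μ Λ (ξ ∩ (Λ : Set E))

open Classical in
/-- `I_Λ - K_Λ` is invertible. -/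
def LocallyInvertible (K : ℓ²(E, ℂ) →L[ℂ] ℓ²(E, ℂ)) (Λ : Finset E) : Prop :=
  IsUnit (1 - restrict K Λ)

open Classical in
/-- `A_[Λ] = K_Λ (I_Λ - K_Λ)⁻¹` (where `I_Λ - K_Λ` is invertible). -/
def localInteraction (K : ℓ²(E, ℂ) →L[ℂ] ℓ²(E, ℂ)) (Λ : Finset E) : Matrix Λ Λ ℂ :=
  restrict K Λ * (1 - restrict K Λ)⁻¹

/-- `‖f‖₋² = (f, A f)₀` for `f ∈ ℓ²(E)`. -/
def normMinusSq (A : ℓ²(E, ℂ) →L[ℂ] ℓ²(E, ℂ)) (f : ℓ²(E, ℂ)) : ℝ :=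
  (⟪f, A f⟫_ℂ).re

/-- The finite linear combinations of the `e_x`, `x ∈ D`. -/
def localFunctions (D : Set E) : Submodule ℂ ℓ²(E, ℂ) :=
  Submodule.span ℂ (basisVec '' D)

/-- `α_Λ = inf {‖e_{x₀} - f‖₋² : f a local function supported on Λ ∩ R₁}`. -/
def alphaLocal (A : ℓ²(E, ℂ) →L[ℂ] ℓ²(E, ℂ)) (x₀ : E) (R₁ : Set E) (Λ : Finset E) : ℝ :=
  ⨅ f : localFunctions ((Λ : Set E) ∩ R₁), normMinusSq A (basisVec x₀ - (f : ℓ²(E, ℂ)))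

end DPP

end

noncomputable section

open scoped ComplexOrder

namespace DPP

/-! The bridge between the two intensities is variational. Since `I - K = (I + A)⁻¹`, the matrix
`A_[Λ]` is the inverse of a compressed resolvent, minus the identity, and its quadratic form at `f`
is the minimum of `‖h‖₀² + ‖f + h‖₋²` over vectors `h` vanishing on `Λ`
(`exists_localInteraction_form` supplies the attaining `h` and the comparison with `h = 0`).

Inclusion and exclusion gives `marginal_eq`: each marginal is a principal minor of `A_[Λ]` times
`det (I - K_Λ)`. That common factor cancels in `α_[Λ]`, leaving a ratio of minors, i.e. a Schur
complement: the minimum of the form of `A_[Λ]` over vectors equal to one at `x₀` and supported on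
`x₀ ξ_Λ`.

Taking `h = 0` yields `α_[Λ] ≤ α_Λ`. Moreover `α_Λ` tends to `‖p‖²`, where `p` is the component of
`e_{x₀}` in `H₋` orthogonal to the local functions on `ξ`. Conversely, pairing with `p` shows that a
nonzero `h` lowers the energy below `‖p‖²` by at most the squared `ℓ²` tail outside `Λ` of one fixed
vector, the adjoint image of `p`. The tail vanishes in the limit, which squeezes `α_[Λ]`. -/

/-! ### Row mixtures of matrices and Schur complements -/

open Classical in
/-- The matrix whose rows with index in `S` are those of `M`, the others being those of `N`. -/
def mixRows {n R : Type*} (M N : Matrix n n R) (S : Set n) : Matrix n n R :=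
  Matrix.of fun i j => if i ∈ S then M i j else N i j

theorem mixRows_apply_of_mem {n R : Type*} (M N : Matrix n n R) {S : Set n} {i : n} (hi : i ∈ S) :
    mixRows M N S i = M i := by
  ext j
  simp only [mixRows, Matrix.of_apply, if_pos hi]

theorem mixRows_apply_of_notMem {n R : Type*} (M N : Matrix n n R) {S : Set n} {i : n} (hi : i ∉ S) :
    mixRows M N S i = N i := by
  ext j
  simp only [mixRows, Matrix.of_apply, if_neg hi]

/-- Identity rows make the matrix block triangular. Padding in this way keeps all minors on one
index type, so that row operations can compare them. -/
theorem det_mixRows_one {n R : Type*} [Fintype n] [DecidableEq n] [CommRing R]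
    (M : Matrix n n R) (S : Set n) [DecidablePred (· ∈ S)] :
    (mixRows M 1 S).det =
      (M.submatrix (Subtype.val : {x // x ∈ S} → n) (Subtype.val : {x // x ∈ S} → n)).det := by
  rw [Matrix.twoBlockTriangular_det (mixRows M 1 S) (· ∈ S)]
  · have h1 : (mixRows M 1 S).toSquareBlockProp (· ∈ S) = M.submatrix Subtype.val Subtype.val := by
      ext i j
      simp only [Matrix.toSquareBlockProp_def, Matrix.of_apply, Matrix.submatrix_apply]
      rw [mixRows_apply_of_mem M 1 i.2]
    have h2 : (mixRows M 1 S).toSquareBlockProp (fun i => ¬ i ∈ S) = 1 := by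
      ext i j
      simp only [Matrix.toSquareBlockProp_def, Matrix.of_apply]
      rw [mixRows_apply_of_notMem M 1 i.2]
      simp [Matrix.one_apply, Subtype.ext_iff]
    rw [h1, h2, Matrix.det_one, mul_one]
  · intro i hi j hj
    rw [mixRows_apply_of_notMem M 1 hi, Matrix.one_apply_ne]
    rintro rfl
    exact hi hj

theorem mixRows_updateRow_one {n R : Type*} [DecidableEq n] [CommRing R]
    (M : Matrix n n R) {S : Set n} {a : n} (ha : a ∉ S) :
    (mixRows M 1 (insert a S)).updateRow a (Pi.single a 1) = mixRows M 1 S := by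
  ext i j
  by_cases hia : i = a
  · subst hia
    rw [Matrix.updateRow_self, mixRows_apply_of_notMem M 1 ha, Matrix.one_apply, Pi.single_apply]
    simp only [eq_comm]
  · rw [Matrix.updateRow_ne hia]
    by_cases hi : i ∈ S
    · rw [mixRows_apply_of_mem M 1 hi, mixRows_apply_of_mem M 1 (Set.mem_insert_of_mem a hi)]
    · rw [mixRows_apply_of_notMem M 1 hi, mixRows_apply_of_notMem M 1]
      simp [hia, hi]

/-- The vector realizing the ratio of the principal minors on `insert a S` and on `S` as the value
of the Schur complement. -/
theorem exists_schur_vector {n F : Type*} [Fintype n] [DecidableEq n] [Field F]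
    (M : Matrix n n F) {S : Set n} {a : n}
    (ha : a ∉ S) (hS : (mixRows M 1 S).det ≠ 0) :
    ∃ v : n → F, v a = 1 ∧ (∀ i ∉ insert a S, v i = 0) ∧ (∀ i ∈ S, (M.mulVec v) i = 0) ∧
      (M.mulVec v) a = (mixRows M 1 (insert a S)).det / (mixRows M 1 S).det := by
  set N := mixRows M 1 (insert a S) with hN
  set d := (mixRows M 1 S).det with hd
  have hadj : N.adjugate a a = d := by
    rw [Matrix.adjugate_apply, hN, mixRows_updateRow_one M ha]
  -- The normalized column `a` of the adjugate solves `N v = (det N / d) e_a` without requiring `det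
  -- N ≠ 0`.
  let v : n → F := d⁻¹ • N.adjugate.mulVec (Pi.single a 1)
  have hv : v a = 1 := by
    simp only [v, Pi.smul_apply, Matrix.mulVec_single_one, Matrix.col_apply, hadj, smul_eq_mul]
    exact inv_mul_cancel₀ hS
  have hNv : N.mulVec v = (N.det / d) • (Pi.single a 1 : n → F) := by
    simp only [v]
    rw [Matrix.mulVec_smul, Matrix.mulVec_mulVec, Matrix.mul_adjugate, Matrix.smul_mulVec,
      Matrix.one_mulVec, smul_smul]
    congr 1
    field_simp
  have hrow : ∀ i ∈ insert a S, M.mulVec v i = N.mulVec v i := by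
    intro i hi
    simp only [Matrix.mulVec]
    rw [hN, mixRows_apply_of_mem M 1 hi]
  refine ⟨v, hv, fun i hi => ?_, fun i hi => ?_, ?_⟩
  · have h := congrFun hNv i
    have hia : i ≠ a := fun h => hi (h ▸ Set.mem_insert a S)
    have h3 : N.mulVec v i = v i := by
      conv_rhs => rw [← Matrix.one_mulVec v]
      simp only [Matrix.mulVec]
      rw [hN, mixRows_apply_of_notMem M 1 hi]
    rw [← h3, h]
    simp [hia]
  · have hia : i ≠ a := fun h => ha (h ▸ hi)
    rw [hrow i (Set.mem_insert_of_mem a hi), hNv]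
    simp [hia]
  · rw [hrow a (Set.mem_insert a S), hNv]
    simp

theorem schur_vector_dotProduct {n : Type*} [Fintype n] {M : Matrix n n ℂ} {S : Set n} {a : n}
    {v u : n → ℂ} {r : ℝ} (hMv : ∀ i ∈ S, (M.mulVec v) i = 0) (hMva : (M.mulVec v) a = r)
    (hua : u a = 1) (hu : ∀ i ∉ insert a S, u i = 0) : star u ⬝ᵥ M.mulVec v = r := by
  rw [dotProduct, Finset.sum_eq_single a, hMva, Pi.star_apply, hua, star_one, one_mul]
  · intro i _ hia
    by_cases hi : i ∈ S
    · rw [hMv i hi, mul_zero]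
    · have h0 := hu i (by simp [hia, hi])
      rw [Pi.star_apply, h0, star_zero, zero_mul]
  · simp

/-- The pairing of `M v` with any competitor is `r`, so the form at `w - v` equals the form at `w`
minus `r`, and it is nonnegative. -/
theorem schur_vector_minimal {n : Type*} [Fintype n] {M : Matrix n n ℂ} (hM : M.PosDef) {S : Set n} {a : n}
    {v w : n → ℂ} {r : ℝ} (hva : v a = 1) (hv0 : ∀ i ∉ insert a S, v i = 0)
    (hMv : ∀ i ∈ S, (M.mulVec v) i = 0) (hMva : (M.mulVec v) a = r)
    (hwa : w a = 1) (hw0 : ∀ i ∉ insert a S, w i = 0) :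
    r ≤ (star w ⬝ᵥ M.mulVec w).re := by
  have h1 := schur_vector_dotProduct hMv hMva hva hv0
  have h2 := schur_vector_dotProduct hMv hMva hwa hw0
  have h3 : star v ⬝ᵥ M.mulVec w = r := by
    have := congrArg star h2
    rw [← Matrix.star_dotProduct_star, star_star, Matrix.star_mulVec, hM.1.eq,
      ← Matrix.dotProduct_mulVec] at this
    simpa using this
  have h4 := (hM.posSemidef.dotProduct_mulVec_nonneg (w - v))
  rw [star_sub, sub_dotProduct, Matrix.mulVec_sub, dotProduct_sub, dotProduct_sub, h1, h2, h3] at h4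
  have h5 := (Complex.le_def.1 h4).1
  simp at h5
  exact h5

/-! ### Cylinder probabilities as determinants -/

/-- Inclusion and exclusion for the determinantal correlation functions. -/
theorem cylinder_eq_det {E n : Type*} [Fintype n] [DecidableEq n] (μ : Measure (Set E))
    [IsProbabilityMeasure μ] (ι : n → E) (M : Matrix n n ℂ)
    (h : ∀ S : Finset n, ((μ.real {ζ : Set E | ∀ x ∈ S, ι x ∈ ζ} : ℝ) : ℂ) =
      (mixRows M 1 (S : Set n)).det) (R : Finset n) :
    ∀ S : Finset n, Disjoint S R →
      ((μ.real {ζ : Set E | (∀ x ∈ S, ι x ∈ ζ) ∧ ∀ x ∈ R, ι x ∉ ζ} : ℝ) : ℂ) =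
        (mixRows M (mixRows (1 - M) 1 (R : Set n)) (S : Set n)).det := by
  induction R using Finset.induction_on with
  | empty =>
    intro S _
    have h1 : mixRows (1 - M) 1 ((∅ : Finset n) : Set n) = 1 := by
      ext i j
      rw [mixRows_apply_of_notMem _ _ (by simp)]
    rw [h1, ← h S]
    simp
  | insert a R ha ih =>
    intro S hS
    rw [Finset.disjoint_insert_right] at hS
    have hmeas : MeasurableSet {ζ : Set E | ι a ∈ ζ} := (measurable_set_mem (ι a)).setOf
    have hadd := measureReal_inter_add_sdiff (μ := μ)
      (s := {ζ : Set E | (∀ x ∈ S, ι x ∈ ζ) ∧ ∀ x ∈ R, ι x ∉ ζ}) hmeas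
    have e1 : {ζ : Set E | (∀ x ∈ S, ι x ∈ ζ) ∧ ∀ x ∈ R, ι x ∉ ζ} ∩ {ζ : Set E | ι a ∈ ζ} =
        {ζ : Set E | (∀ x ∈ insert a S, ι x ∈ ζ) ∧ ∀ x ∈ R, ι x ∉ ζ} := by
      ext ζ
      simp only [Set.mem_inter_iff, Set.mem_ofPred_eq, Finset.forall_mem_insert]
      tauto
    have e2 : {ζ : Set E | (∀ x ∈ S, ι x ∈ ζ) ∧ ∀ x ∈ R, ι x ∉ ζ} \ {ζ : Set E | ι a ∈ ζ} =
        {ζ : Set E | (∀ x ∈ S, ι x ∈ ζ) ∧ ∀ x ∈ insert a R, ι x ∉ ζ} := by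
      ext ζ
      simp only [Set.mem_sdiff, Set.mem_ofPred_eq, Finset.forall_mem_insert]
      tauto
    rw [e1, e2] at hadd
    have ih1 := ih S hS.2
    have ih2 := ih (insert a S) (Finset.disjoint_insert_left.2 ⟨ha, hS.2⟩)
    rw [← hadd, Complex.ofReal_add, ih2] at ih1
    rw [← add_right_inj, ih1]
    set B := mixRows M (mixRows (1 - M) 1 (R : Set n)) (S : Set n) with hB
    have haS : a ∉ (S : Set n) := by simpa using hS.1
    have haR : a ∉ (R : Set n) := by simpa using ha
    -- Row `a` of `B` is still the identity row. Splitting it as `M a + (1 - M) a` mirrors splitting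
    -- the event by whether `ι a ∈ ζ`.
    have d0 : B = B.updateRow a (M a + (1 - M) a) := by
      have : B a = M a + (1 - M) a := by
        rw [hB, mixRows_apply_of_notMem _ _ haS, mixRows_apply_of_notMem _ _ haR]
        ext j
        simp
      rw [← this, Matrix.updateRow_eq_self]
    have d1 : mixRows M (mixRows (1 - M) 1 (R : Set n)) ((insert a S : Finset n) : Set n) =
        B.updateRow a (M a) := by
      ext i j
      by_cases hia : i = a
      · subst hia
        simp [mixRows, hS.1]
      · simp [mixRows, hB, hia]
    have d2 : mixRows M (mixRows (1 - M) 1 ((insert a R : Finset n) : Set n)) (S : Set n) =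
        B.updateRow a ((1 - M) a) := by
      ext i j
      by_cases hia : i = a
      · subst hia
        simp [mixRows, hS.1]
      · simp [mixRows, hB, hia]
    rw [d1, d2]
    conv_lhs => rw [d0]
    exact Matrix.det_updateRow_add B a _ _

/-- Factoring `1 - M` out on the right turns the determinant of a cylinder event into a principal
minor of `M (1 - M)⁻¹` times `det (1 - M)`. -/
theorem mixRows_eq_mul {n R : Type*} [Fintype n] [DecidableEq n] [CommRing R] (M : Matrix n n R)
    (hM : IsUnit (1 - M)) (S : Set n) :
    mixRows M (1 - M) S = mixRows (M * (1 - M)⁻¹) 1 S * (1 - M) := by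
  have hdet := (Matrix.isUnit_iff_isUnit_det _).1 hM
  ext i j
  by_cases hi : i ∈ S
  · have : (M * (1 - M)⁻¹ * (1 - M) : Matrix n n R) i j = M i j := by
      rw [Matrix.mul_assoc, Matrix.nonsing_inv_mul _ hdet, Matrix.mul_one]
    rw [mixRows_apply_of_mem _ _ hi, ← this, Matrix.mul_apply, Matrix.mul_apply,
      mixRows_apply_of_mem _ _ hi]
  · have : ((1 : Matrix n n R) * (1 - M) : Matrix n n R) i j = (1 - M) i j := by rw [Matrix.one_mul]
    rw [mixRows_apply_of_notMem _ _ hi, ← this, Matrix.mul_apply, Matrix.mul_apply,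
      mixRows_apply_of_notMem _ _ hi]

/-! ### Finitely supported vectors and compressions of operators -/

variable {E : Type u}

theorem inner_self_eq_ofReal {V : Type*} [NormedAddCommGroup V] [InnerProductSpace ℂ V] (f : V) :
    ⟪f, f⟫_ℂ = ((‖f‖ ^ 2 : ℝ) : ℂ) := by
  rw [inner_self_eq_norm_sq_to_K]
  norm_cast

theorem inner_basisVec (x : E) (f : ℓ²(E, ℂ)) : ⟪basisVec x, f⟫_ℂ = f x := by
  classical
  rw [basisVec, lp.inner_single_left]
  simp

/-- The extension by zero of a function on a finite set to an element of `ℓ²(E)`. -/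
def extendZero {Λ : Finset E} (u : Λ → ℂ) : ℓ²(E, ℂ) :=
  ∑ x : Λ, u x • basisVec (x : E)

theorem inner_extendZero {Λ : Finset E} (u : Λ → ℂ) (f : ℓ²(E, ℂ)) :
    ⟪extendZero u, f⟫_ℂ = star u ⬝ᵥ fun x : Λ => f x := by
  simp only [extendZero, sum_inner, inner_smul_left, inner_basisVec, dotProduct, Pi.star_apply]
  rfl

theorem inner_extendZero_right {Λ : Finset E} (u : Λ → ℂ) (f : ℓ²(E, ℂ)) :
    ⟪f, extendZero u⟫_ℂ = star (fun x : Λ => f x) ⬝ᵥ u := by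
  rw [← inner_conj_symm, inner_extendZero, dotProduct_comm, starRingEnd_apply,
    ← Matrix.star_dotProduct_star, star_star]
  rw [dotProduct_comm]

theorem basisVec_apply_self (x : E) : (basisVec x : ℓ²(E, ℂ)) x = 1 := by
  simp [basisVec]

theorem basisVec_apply_ne {x y : E} (h : y ≠ x) : (basisVec x : ℓ²(E, ℂ)) y = 0 := by
  simp [basisVec, h]

theorem extendZero_apply {Λ : Finset E} (u : Λ → ℂ) (x : Λ) :
    (extendZero u) (x : E) = u x := by
  rw [← inner_basisVec, extendZero, inner_sum, Finset.sum_eq_single x]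
  · rw [inner_smul_right, inner_basisVec, basisVec_apply_self, mul_one]
  · intro y _ hy
    rw [inner_smul_right, inner_basisVec, basisVec_apply_ne, mul_zero]
    exact fun h => hy (Subtype.ext h.symm)
  · simp

theorem extendZero_apply_notMem {Λ : Finset E} (u : Λ → ℂ) {y : E} (hy : y ∉ Λ) :
    (extendZero u) y = 0 := by
  rw [← inner_basisVec, extendZero, inner_sum]
  refine Finset.sum_eq_zero fun x _ => ?_
  rw [inner_smul_right, inner_basisVec, basisVec_apply_ne, mul_zero]
  rintro rfl
  exact hy x.2

theorem restrict_mulVec (T : ℓ²(E, ℂ) →L[ℂ] ℓ²(E, ℂ)) {Λ : Finset E} (u : Λ → ℂ) :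
    (restrict T Λ).mulVec u = fun x : Λ => (T (extendZero u)) (x : E) := by
  ext x
  rw [← inner_basisVec, extendZero, map_sum, inner_sum, Matrix.mulVec, dotProduct]
  refine Finset.sum_congr rfl fun y _ => ?_
  rw [map_smul, inner_smul_right, mul_comm]
  rfl

theorem restrict_isHermitian {T : ℓ²(E, ℂ) →L[ℂ] ℓ²(E, ℂ)}
    (hT : ∀ f g, ⟪T f, g⟫_ℂ = ⟪f, T g⟫_ℂ) (Λ : Finset E) : (restrict T Λ).IsHermitian := by
  ext x y
  simp only [Matrix.conjTranspose_apply, restrict, Matrix.of_apply, kernel]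
  rw [← hT]
  exact inner_conj_symm _ _

theorem extendZero_ne_zero {Λ : Finset E} {u : Λ → ℂ} (hu : u ≠ 0) : extendZero u ≠ 0 := by
  intro h
  apply hu
  ext x
  rw [← extendZero_apply u x, h]
  rfl

theorem restrict_posDef {T : ℓ²(E, ℂ) →L[ℂ] ℓ²(E, ℂ)}
    (hT : ∀ f g, ⟪T f, g⟫_ℂ = ⟪f, T g⟫_ℂ) (hpos : ∀ f, f ≠ 0 → 0 < ⟪f, T f⟫_ℂ) (Λ : Finset E) :
    (restrict T Λ).PosDef := by
  refine Matrix.PosDef.of_dotProduct_mulVec_pos (restrict_isHermitian hT Λ) fun u hu => ?_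
  rw [restrict_mulVec, ← inner_extendZero]
  exact hpos _ (extendZero_ne_zero hu)

/-! ### The resolvent of `A` and the quadratic form of `A_[Λ]` -/

section Resolvent

variable {A : ℓ²(E, ℂ) →L[ℂ] ℓ²(E, ℂ)}

theorem one_add_apply_inverse (hA : A.IsPositive) (f : ℓ²(E, ℂ)) :
    Ring.inverse (1 + A) f + A (Ring.inverse (1 + A) f) = f := by
  have h := congrArg (fun T : ℓ²(E, ℂ) →L[ℂ] ℓ²(E, ℂ) => T f)
    (Ring.mul_inverse_cancel _ (isUnit_one_add hA))
  simpa using h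

theorem correlationOp_eq (hA : A.IsPositive) :
    correlationOp A = 1 - Ring.inverse (1 + A) := by
  ext1 f
  have h := one_add_apply_inverse hA f
  simp only [correlationOp, mul_apply_eq_comp, sub_apply,
    one_apply_eq_self]
  exact eq_sub_of_add_eq' h

theorem inverse_symmetric (hA : A.IsPositive) (f g : ℓ²(E, ℂ)) :
    ⟪Ring.inverse (1 + A) f, g⟫_ℂ = ⟪f, Ring.inverse (1 + A) g⟫_ℂ := by
  have hs : ∀ f g, ⟪A f, g⟫_ℂ = ⟪f, A g⟫_ℂ := fun f g => hA.1 f g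
  conv_lhs => rw [← one_add_apply_inverse hA g]
  conv_rhs => rw [← one_add_apply_inverse hA f]
  rw [inner_add_left, inner_add_right, hs]

/-- With `g = (1 + A)⁻¹ f`, the inner product is `‖g‖² + (g, A g)`, and `g ≠ 0`. -/
theorem inner_inverse_pos (hA : A.IsPositive) {f : ℓ²(E, ℂ)} (hf : f ≠ 0) :
    0 < ⟪f, Ring.inverse (1 + A) f⟫_ℂ := by
  have hs : ∀ f g, ⟪A f, g⟫_ℂ = ⟪f, A g⟫_ℂ := fun f g => hA.1 f g
  have h := one_add_apply_inverse hA f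
  set g := Ring.inverse (1 + A) f
  have hg : g ≠ 0 := by
    intro h0
    rw [h0, map_zero, add_zero] at h
    exact hf h.symm
  rw [← h, inner_add_left, hs]
  refine add_pos_of_pos_of_nonneg ?_ (hA.inner_nonneg_right g)
  rw [inner_self_eq_ofReal]
  have : 0 < ‖g‖ ^ 2 := by positivity
  exact_mod_cast this

open Classical in
theorem one_sub_restrict_correlationOp (hA : A.IsPositive) (Λ : Finset E) :
    1 - restrict (correlationOp A) Λ = restrict (Ring.inverse (1 + A)) Λ := by
  rw [correlationOp_eq hA]
  ext x y
  simp only [Matrix.sub_apply, restrict, Matrix.of_apply, kernel, sub_apply,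
    inner_sub_right, one_apply_eq_self]
  rw [inner_basisVec (x : E) (basisVec (y : E))]
  by_cases hxy : x = y
  · subst hxy
    rw [basisVec_apply_self]
    simp
  · rw [basisVec_apply_ne fun h => hxy (Subtype.ext h), Matrix.one_apply_ne hxy]
    simp

open Classical in
theorem one_sub_restrict_posDef (hA : A.IsPositive) (Λ : Finset E) :
    (1 - restrict (correlationOp A) Λ).PosDef := by
  rw [one_sub_restrict_correlationOp hA]
  exact restrict_posDef (inverse_symmetric hA) (fun f hf => inner_inverse_pos hA hf) Λ

theorem locallyInvertible_correlationOp (hA : A.IsPositive) (Λ : Finset E) :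
    LocallyInvertible (correlationOp A) Λ := by
  classical
  exact (Matrix.isUnit_iff_isUnit_det _).2
    (one_sub_restrict_posDef hA Λ).det_pos.ne'.isUnit

open Classical in
theorem localInteraction_eq (hA : A.IsPositive) (Λ : Finset E) :
    localInteraction (correlationOp A) Λ = (1 - restrict (correlationOp A) Λ)⁻¹ - 1 := by
  have hdet : IsUnit (1 - restrict (correlationOp A) Λ).det :=
    (one_sub_restrict_posDef hA Λ).det_pos.ne'.isUnit
  have h := Matrix.mul_nonsing_inv _ hdet
  rw [Matrix.sub_mul, Matrix.one_mul] at h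
  rw [localInteraction]
  rw [sub_eq_iff_eq_add] at h
  exact eq_sub_of_add_eq' h.symm

/-- The quadratic form of `A_[Λ]` is obtained from that of `A` by minimizing
`‖f + h‖₋² + ‖h‖₀²` over the vectors `h` vanishing on `Λ`. -/
theorem exists_localInteraction_form (hA : A.IsPositive) {Λ : Finset E} (f : Λ → ℂ) :
    ∃ h : ℓ²(E, ℂ), (∀ x ∈ Λ, h x = 0) ∧
      star f ⬝ᵥ (localInteraction (correlationOp A) Λ).mulVec f =
        ⟪h, h⟫_ℂ + ⟪extendZero f + h, A (extendZero f + h)⟫_ℂ ∧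
      star f ⬝ᵥ (localInteraction (correlationOp A) Λ).mulVec f ≤
        ⟪extendZero f, A (extendZero f)⟫_ℂ := by
  classical
  have hs : ∀ f g, ⟪A f, g⟫_ℂ = ⟪f, A g⟫_ℂ := fun f g => hA.1 f g
  have hdet : IsUnit (1 - restrict (correlationOp A) Λ).det :=
    (one_sub_restrict_posDef hA Λ).det_pos.ne'.isUnit
  set u := ((1 - restrict (correlationOp A) Λ)⁻¹).mulVec f with hu
  set g := Ring.inverse (1 + A) (extendZero u) with hg
  -- This is the Euler–Lagrange equation of the minimization: `(1 + A) g` is supported on `Λ`, hence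
  -- orthogonal to every vector vanishing there, while `g` agrees with `f` on `Λ`.
  have hgA : g + A g = extendZero u := one_add_apply_inverse hA _
  have hgf : (fun x : Λ => g (x : E)) = f := by
    rw [hg, ← restrict_mulVec, ← one_sub_restrict_correlationOp hA, hu, Matrix.mulVec_mulVec,
      Matrix.mul_nonsing_inv _ hdet, Matrix.one_mulVec]
  set h := g - extendZero f with hh
  have hsum : extendZero f + h = g := by rw [hh]; abel
  have h0 : ∀ x ∈ Λ, h x = 0 := by
    intro x hx
    have := congrFun hgf ⟨x, hx⟩
    rw [hh, lp.coeFn_sub, Pi.sub_apply, extendZero_apply f ⟨x, hx⟩]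
    exact sub_eq_zero.2 this
  have horth : ∀ w : Λ → ℂ, ⟪extendZero w, h⟫_ℂ = 0 := by
    intro w
    rw [inner_extendZero]
    have : (fun x : Λ => h (x : E)) = 0 := funext fun x => h0 x x.2
    rw [this, dotProduct_zero]
  have horth' : ∀ w : Λ → ℂ, ⟪h, extendZero w⟫_ℂ = 0 := by
    intro w
    rw [← inner_conj_symm, horth, map_zero]
  have hff : ⟪extendZero f, extendZero f⟫_ℂ = star f ⬝ᵥ f := by
    rw [inner_extendZero]
    congr 1
    exact funext fun x => extendZero_apply f x
  have hgg : ⟪g, g⟫_ℂ = star f ⬝ᵥ f + ⟪h, h⟫_ℂ := by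
    rw [← hsum, inner_add_left, inner_add_right, inner_add_right, horth, horth', hff]
    ring
  have hform : star f ⬝ᵥ (localInteraction (correlationOp A) Λ).mulVec f =
      ⟪h, h⟫_ℂ + ⟪g, A g⟫_ℂ := by
    rw [localInteraction_eq hA, Matrix.sub_mulVec, Matrix.one_mulVec, dotProduct_sub, ← hu]
    have h1 : ⟪g, g + A g⟫_ℂ = star f ⬝ᵥ u := by
      rw [hgA, inner_extendZero_right, hgf]
    rw [← h1, inner_add_right, hgg]
    ring
  refine ⟨h, h0, by rw [hform, hsum], ?_⟩
  have hfg : extendZero f = g - h := by rw [hh]; abel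
  have e1 : ⟪h, A g⟫_ℂ = - ⟪h, g⟫_ℂ := by
    have := horth' u
    rw [← hgA, inner_add_right] at this
    exact eq_neg_of_add_eq_zero_right this
  have e2 : ⟪g, A h⟫_ℂ = - ⟪g, h⟫_ℂ := by
    have := horth u
    rw [← hgA, inner_add_left, hs] at this
    exact eq_neg_of_add_eq_zero_right this
  have e3 : ⟪g, h⟫_ℂ = ⟪h, h⟫_ℂ := by rw [← hsum, inner_add_left, horth, zero_add]
  have e4 : ⟪h, g⟫_ℂ = ⟪h, h⟫_ℂ := by rw [← hsum, inner_add_right, horth', zero_add]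
  -- The excess of the form of `A` over that of `A_[Λ]` is exactly `‖h‖² + (h, A h)`.
  have e5 : ⟪extendZero f, A (extendZero f)⟫_ℂ =
      (⟪h, h⟫_ℂ + ⟪g, A g⟫_ℂ) + (⟪h, h⟫_ℂ + ⟪h, A h⟫_ℂ) := by
    rw [hfg, map_sub, inner_sub_left, inner_sub_right, inner_sub_right, e1, e2, e3, e4]
    ring
  rw [hform, e5]
  refine le_add_of_nonneg_right (add_nonneg ?_ (hA.inner_nonneg_right h))
  rw [inner_self_eq_ofReal]
  have : 0 ≤ ‖h‖ ^ 2 := by positivity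
  exact_mod_cast this

/-- The variational formula bounds the form below by that of `A` at `f + h`, which is nonzero
because it agrees with `f` on `Λ`. -/
theorem localInteraction_posDef (hA : A.IsPositive)
    (hpos : ∀ f, f ≠ 0 → 0 < ⟪f, A f⟫_ℂ) (Λ : Finset E) :
    (localInteraction (correlationOp A) Λ).PosDef := by
  classical
  refine Matrix.PosDef.of_dotProduct_mulVec_pos ?_ fun f hf => ?_
  · rw [localInteraction_eq hA]
    exact (one_sub_restrict_posDef hA Λ).1.inv.sub Matrix.isHermitian_one
  · obtain ⟨h, h0, hform, -⟩ := exists_localInteraction_form hA f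
    rw [hform]
    refine add_pos_of_nonneg_of_pos ?_ (hpos _ ?_)
    · rw [inner_self_eq_ofReal]
      have : 0 ≤ ‖h‖ ^ 2 := by positivity
      exact_mod_cast this
    · intro h1
      apply hf
      ext x
      have h2 := congrArg (fun g : ℓ²(E, ℂ) => g (x : E)) h1
      simpa [extendZero_apply, h0 x x.2] using h2

end Resolvent

/-! ### Marginals as principal minors of `A_[Λ]` -/

section Marginals

theorem minor_eq_det_mixRows {Λ : Finset E} [DecidableEq Λ] (M : Matrix Λ Λ ℂ) (S : Set E) :
    minor M S = (mixRows M 1 {x : Λ | (x : E) ∈ S}).det := by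
  classical
  rw [det_mixRows_one, minor]
  convert rfl <;> exact Iff.rfl

theorem minor_pos {Λ : Finset E} {M : Matrix Λ Λ ℂ} (hM : M.PosDef) (S : Set E) :
    0 < minor M S := by
  classical
  exact (hM.submatrix Subtype.val_injective).det_pos

/-- The minor of the kernel on a subset of `Λ`, computed in `Λ`. -/
theorem minor_restrict_map (T : ℓ²(E, ℂ) →L[ℂ] ℓ²(E, ℂ)) {Λ : Finset E} [DecidableEq Λ]
    (S : Finset Λ) :
    minor (restrict T (S.map (Function.Embedding.subtype _)))
      (S.map (Function.Embedding.subtype _) : Finset E) =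
      (mixRows (restrict T Λ) 1 (S : Set Λ)).det := by
  classical
  rw [det_mixRows_one, minor]
  let e : {x : Λ // x ∈ (S : Set Λ)} ≃
      {x : (S.map (Function.Embedding.subtype (· ∈ Λ)) : Finset E) //
        (x : E) ∈ ((S.map (Function.Embedding.subtype (· ∈ Λ)) : Finset E) : Set E)} :=
    { toFun := fun x => ⟨⟨x.1.1, Finset.mem_map.2 ⟨x.1, x.2, rfl⟩⟩,
        Finset.mem_map.2 ⟨x.1, x.2, rfl⟩⟩
      invFun := fun x => ⟨⟨x.1.1, by
          obtain ⟨y, _, hy⟩ := Finset.mem_map.1 x.1.2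
          rw [← hy]; exact y.2⟩, by
          obtain ⟨y, hyS, hy⟩ := Finset.mem_map.1 x.1.2
          have : y = ⟨x.1.1, by rw [← hy]; exact y.2⟩ := Subtype.ext hy
          rw [← this]; exact hyS⟩
      left_inv := fun x => rfl
      right_inv := fun x => rfl }
  have he : (restrict T Λ).submatrix (Subtype.val : {x : Λ // x ∈ (S : Set Λ)} → Λ) Subtype.val =
      ((restrict T (S.map (Function.Embedding.subtype (· ∈ Λ)))).submatrix Subtype.val
        Subtype.val).submatrix e e := rfl
  rw [he]
  convert (Matrix.det_submatrix_equiv_self e _).symm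

open Classical in
theorem marginal_eq {K : ℓ²(E, ℂ) →L[ℂ] ℓ²(E, ℂ)} {μ : Measure (Set E)} (hμ : IsDPP K μ)
    {Λ : Finset E} (hK : LocallyInvertible K Λ) (S : Set E) :
    ((marginal μ Λ (S ∩ (Λ : Set E)) : ℝ) : ℂ) =
      minor (localInteraction K Λ) S * (1 - restrict K Λ).det := by
  have := hμ.isProbabilityMeasure
  have hcor : ∀ T : Finset Λ, ((μ.real {ζ : Set E | ∀ x ∈ T, (x : E) ∈ ζ} : ℝ) : ℂ) =
      (mixRows (restrict K Λ) 1 (T : Set Λ)).det := by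
    intro T
    rw [← minor_restrict_map, ← hμ.correlation]
    congr 2
    ext ζ
    simp [Set.subset_def]
  let T : Finset Λ := Finset.univ.filter fun x => (x : E) ∈ S
  have h := cylinder_eq_det μ (fun x : Λ => (x : E)) (restrict K Λ) hcor Tᶜ T disjoint_compl_right
  have hT : (T : Set Λ) = {x : Λ | (x : E) ∈ S} := by
    ext x
    simp [T]
  have e1 : {ζ : Set E | (∀ x ∈ T, (x : E) ∈ ζ) ∧ ∀ x ∈ Tᶜ, (x : E) ∉ ζ} =
      {ζ : Set E | ζ ∩ (Λ : Set E) = S ∩ (Λ : Set E)} := by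
    ext ζ
    simp only [T, Finset.mem_filter, Finset.mem_compl, Finset.mem_univ, true_and, Subtype.forall,
      Set.mem_ofPred_eq, Set.ext_iff, Set.mem_inter_iff, Finset.mem_coe]
    constructor
    · rintro ⟨h1, h2⟩ x
      by_cases hx : x ∈ Λ
      · have := h1 x hx
        have := h2 x hx
        tauto
      · tauto
    · intro h1
      exact ⟨fun x hx hS => ((h1 x).2 ⟨hS, hx⟩).1, fun x hx hS hz => hS ((h1 x).1 ⟨hz, hx⟩).1⟩
  -- The sets `T` and `Tᶜ` exhaust `Λ`, so no identity row remains.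
  have e2 : mixRows (restrict K Λ) (mixRows (1 - restrict K Λ) 1 ((Tᶜ : Finset Λ) : Set Λ))
      (T : Set Λ) = mixRows (restrict K Λ) (1 - restrict K Λ) (T : Set Λ) := by
    ext i j
    by_cases hi : i ∈ T <;> simp [mixRows, hi]
  rw [e1, e2, mixRows_eq_mul _ hK, Matrix.det_mul, hT] at h
  rw [marginal, h, minor_eq_det_mixRows, localInteraction]

end Marginals

/-! ### The embedding into `H₋`, local functions and tails -/

/-- The map is the inclusion into `H₋`. Functional completion makes it injective, since the image of
`f` has the same point values as `f`. -/
theorem HypothesisH.exists_factorization {A : ℓ²(E, ℂ) →L[ℂ] ℓ²(E, ℂ)} (hA : HypothesisH A) :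
    ∃ (H : Type u) (_ : NormedAddCommGroup H) (_ : InnerProductSpace ℂ H) (_ : CompleteSpace H)
      (T : ℓ²(E, ℂ) →L[ℂ] H),
      (∀ f g, ⟪T f, T g⟫_ℂ = ⟪f, A g⟫_ℂ) ∧ ∀ f, T f = 0 → f = 0 := by
  obtain ⟨H, _, _, hc, _, j, hj, hinner, -⟩ := hA.functionallyCompleted
  -- The constant only has to dominate the square root of `‖A‖`.
  have hnorm : ∀ f, ‖j f‖ ≤ (‖A‖ + 1) * ‖f‖ := by
    intro f
    have h1 : ‖j f‖ ^ 2 ≤ ‖A‖ * ‖f‖ ^ 2 := by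
      have h := norm_inner_le_norm (𝕜 := ℂ) f (A f)
      rw [← hinner, inner_self_eq_ofReal, Complex.norm_of_nonneg (by positivity)] at h
      have h2 := mul_le_mul_of_nonneg_left (A.le_opNorm f) (norm_nonneg f)
      nlinarith
    refine abs_le_of_sq_le_sq' ?_ (by positivity) |>.2
    nlinarith [norm_nonneg A, sq_nonneg ‖f‖, mul_nonneg (norm_nonneg A) (sq_nonneg ‖f‖),
      mul_nonneg (sq_nonneg ‖A‖) (sq_nonneg ‖f‖)]
  refine ⟨H, _, _, hc, j.mkContinuous (‖A‖ + 1) hnorm, hinner, fun f hf => ?_⟩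
  ext x
  rw [← hj f x]
  have : j f = 0 := hf
  rw [this]
  simp

theorem localFunctions_mono {D D' : Set E} (h : D ⊆ D') : localFunctions D ≤ localFunctions D' :=
  Submodule.span_mono (Set.image_mono h)

theorem apply_eq_zero_of_mem_localFunctions {D : Set E} {f : ℓ²(E, ℂ)} (hf : f ∈ localFunctions D)
    {y : E} (hy : y ∉ D) : f y = 0 := by
  rw [← inner_basisVec]
  induction hf using Submodule.span_induction with
  | mem x hx =>
    obtain ⟨z, hz, rfl⟩ := hx
    rw [inner_basisVec, basisVec_apply_ne]
    rintro rfl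
    exact hy hz
  | zero => simp
  | add f g _ _ hf hg => rw [inner_add_right, hf, hg, add_zero]
  | smul c f _ hf => rw [inner_smul_right, hf, mul_zero]

theorem exists_finset_mem_localFunctions {D : Set E} {f : ℓ²(E, ℂ)} (hf : f ∈ localFunctions D) :
    ∃ Λ : Finset E, f ∈ localFunctions ((Λ : Set E) ∩ D) := by
  classical
  induction hf using Submodule.span_induction with
  | mem x hx =>
    obtain ⟨z, hz, rfl⟩ := hx
    exact ⟨{z}, Submodule.subset_span ⟨z, by simp [hz], rfl⟩⟩
  | zero => exact ⟨∅, Submodule.zero_mem _⟩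
  | add f g _ _ hf hg =>
    obtain ⟨Λ₁, h₁⟩ := hf
    obtain ⟨Λ₂, h₂⟩ := hg
    refine ⟨Λ₁ ∪ Λ₂, Submodule.add_mem _ (localFunctions_mono ?_ h₁) (localFunctions_mono ?_ h₂)⟩
    · exact Set.inter_subset_inter_left _ (by simp)
    · exact Set.inter_subset_inter_left _ (by simp)
  | smul c f _ hf =>
    obtain ⟨Λ, h⟩ := hf
    exact ⟨Λ, Submodule.smul_mem _ c h⟩

theorem basisVec_sub_extendZero_mem {Λ : Finset E} {x₀ : E} (hx : x₀ ∈ Λ) {ξ : Set E} {v : Λ → ℂ}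
    (hv : v ⟨x₀, hx⟩ = 1) (hv0 : ∀ x : Λ, (x : E) ∉ insert x₀ ξ → v x = 0) :
    basisVec x₀ - extendZero v ∈ localFunctions ((Λ : Set E) ∩ ξ) := by
  classical
  rw [extendZero, ← Finset.add_sum_erase _ _ (Finset.mem_univ (⟨x₀, hx⟩ : Λ)), hv, one_smul,
    sub_add_cancel_left]
  refine Submodule.neg_mem _ (Submodule.sum_mem _ fun x hxm => ?_)
  by_cases hxξ : (x : E) ∈ ξ
  · exact Submodule.smul_mem _ _ (Submodule.subset_span ⟨x, ⟨x.2, hxξ⟩, rfl⟩)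
  · rw [hv0 x, zero_smul]
    · exact Submodule.zero_mem _
    · rintro (h | h)
      · exact (Finset.mem_erase.1 hxm).1 (Subtype.ext h)
      · exact hxξ h

theorem extendZero_restriction {Λ : Finset E} {g : ℓ²(E, ℂ)} (hg : ∀ y ∉ Λ, g y = 0) :
    extendZero (fun x : Λ => g (x : E)) = g := by
  ext y
  by_cases hy : y ∈ Λ
  · exact extendZero_apply (fun x : Λ => g (x : E)) ⟨y, hy⟩
  · rw [extendZero_apply_notMem _ hy, hg y hy]

/-- The tail of a vector of `ℓ²(E)` outside large finite sets. -/
theorem tendsto_norm_sub_sum_single [DecidableEq E] (q : ℓ²(E, ℂ)) :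
    Tendsto (fun Λ : Finset E => ‖q - ∑ x ∈ Λ, lp.single 2 x (q x)‖) atTop (𝓝 0) := by
  have h : Tendsto (fun Λ : Finset E => ∑ x ∈ Λ, lp.single 2 x (q x)) atTop (𝓝 q) :=
    lp.hasSum_single (by norm_num) q
  simpa using (h.const_sub q).norm

theorem inner_eq_inner_tail [DecidableEq E] (q h : ℓ²(E, ℂ)) {Λ : Finset E}
    (hh : ∀ x ∈ Λ, h x = 0) : ⟪q, h⟫_ℂ = ⟪q - ∑ x ∈ Λ, lp.single 2 x (q x), h⟫_ℂ := by
  rw [inner_sub_left, sum_inner, Finset.sum_eq_zero, sub_zero]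
  intro x hx
  rw [lp.inner_single_left, hh x hx, inner_zero_right]

/-! ### Local intensities and their limit -/

section Intensity

variable {A : ℓ²(E, ℂ) →L[ℂ] ℓ²(E, ℂ)} {μ : Measure (Set E)} {x₀ : E} {ξ : Set E}

theorem HypothesisH.inner_pos (hA : HypothesisH A) {f : ℓ²(E, ℂ)} (hf : f ≠ 0) :
    0 < ⟪f, A f⟫_ℂ := by
  obtain ⟨H, _, _, _, T, hT, hinj⟩ := hA.exists_factorization
  rw [← hT, inner_self_eq_ofReal]
  have : 0 < ‖T f‖ := norm_pos_iff.2 fun h => hf (hinj f h)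
  have : 0 < ‖T f‖ ^ 2 := by positivity
  exact_mod_cast this

theorem HypothesisH.minor_localInteraction_pos (hA : HypothesisH A) (Λ : Finset E) (S : Set E) :
    0 < minor (localInteraction (correlationOp A) Λ) S :=
  minor_pos (localInteraction_posDef hA.isPositive (fun _ hf => hA.inner_pos hf) Λ) S

theorem HypothesisH.minor_localInteraction_ne_zero (hA : HypothesisH A) (Λ : Finset E)
    (S : Set E) : minor (localInteraction (correlationOp A) Λ) S ≠ 0 :=
  (hA.minor_localInteraction_pos Λ S).ne'

theorem marginal_pos (hA : HypothesisH A) (hμ : IsDPP (correlationOp A) μ) (Λ : Finset E)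
    (S : Set E) : 0 < marginal μ Λ (S ∩ (Λ : Set E)) := by
  classical
  have h := marginal_eq hμ (locallyInvertible_correlationOp hA.isPositive Λ) S
  have h1 : (0 : ℂ) < ((marginal μ Λ (S ∩ (Λ : Set E)) : ℝ) : ℂ) := by
    rw [h]
    exact mul_pos (hA.minor_localInteraction_pos Λ S)
      (one_sub_restrict_posDef hA.isPositive Λ).det_pos
  exact_mod_cast h1

theorem localIntensity_eq (hA : HypothesisH A) (hμ : IsDPP (correlationOp A) μ) {Λ : Finset E}
    (hx : x₀ ∈ Λ) :
    (localIntensity μ x₀ ξ Λ : ℂ) =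
      minor (localInteraction (correlationOp A) Λ) (insert x₀ ξ) /
        minor (localInteraction (correlationOp A) Λ) ξ := by
  classical
  have hloc := locallyInvertible_correlationOp hA.isPositive Λ
  have hset : insert x₀ (ξ ∩ (Λ : Set E)) = insert x₀ ξ ∩ (Λ : Set E) := by
    rw [Set.insert_inter_of_mem (by exact_mod_cast hx)]
  rw [localIntensity, hset, Complex.ofReal_div, marginal_eq hμ hloc, marginal_eq hμ hloc]
  exact mul_div_mul_right _ _ (one_sub_restrict_posDef hA.isPositive Λ).det_pos.ne'

/-- The Schur complement representing the local intensity. -/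
theorem exists_localIntensity_vector (hA : HypothesisH A) (hμ : IsDPP (correlationOp A) μ)
    (hx₀ : x₀ ∉ ξ) {Λ : Finset E} (hx : x₀ ∈ Λ) :
    (∃ v : Λ → ℂ, basisVec x₀ - extendZero v ∈ localFunctions ((Λ : Set E) ∩ ξ) ∧
      star v ⬝ᵥ (localInteraction (correlationOp A) Λ).mulVec v = localIntensity μ x₀ ξ Λ) ∧
    ∀ w : Λ → ℂ, w ⟨x₀, hx⟩ = 1 → (∀ x : Λ, (x : E) ∉ insert x₀ ξ → w x = 0) →
      localIntensity μ x₀ ξ Λ ≤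
        (star w ⬝ᵥ (localInteraction (correlationOp A) Λ).mulVec w).re := by
  classical
  set M := localInteraction (correlationOp A) Λ with hM
  have hpd : M.PosDef :=
    localInteraction_posDef hA.isPositive (fun _ hf => hA.inner_pos hf) Λ
  let S : Set Λ := {x : Λ | (x : E) ∈ ξ}
  let a : Λ := ⟨x₀, hx⟩
  have haS : a ∉ S := hx₀
  have hins : {x : Λ | (x : E) ∈ insert x₀ ξ} = insert a S := by
    ext x
    exact or_congr ⟨fun h => Subtype.ext h, congrArg Subtype.val⟩ Iff.rfl
  have hdet : (mixRows M 1 S).det ≠ 0 := by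
    rw [← minor_eq_det_mixRows M ξ]
    exact hA.minor_localInteraction_ne_zero Λ ξ
  obtain ⟨v, hva, hv0, hMv, hMva⟩ := exists_schur_vector M haS hdet
  rw [← hins, ← minor_eq_det_mixRows M ξ, ← minor_eq_det_mixRows M (insert x₀ ξ), hM,
    ← localIntensity_eq hA hμ hx, ← hM] at hMva
  have hmem : ∀ x : Λ, x ∉ insert a S → (x : E) ∉ insert x₀ ξ := by
    intro x h h'
    rw [← hins] at h
    exact h h'
  have hmem' : ∀ x : Λ, (x : E) ∉ insert x₀ ξ → x ∉ insert a S := by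
    intro x h h'
    rw [← hins] at h'
    exact h h'
  refine ⟨⟨v, basisVec_sub_extendZero_mem hx hva fun x h => hv0 x (hmem' x h),
    schur_vector_dotProduct hMv hMva hva hv0⟩, fun w hwa hw0 => ?_⟩
  exact schur_vector_minimal hpd hva hv0 hMv hMva hwa fun x h => hw0 x (hmem x h)

/-- Both sides are infima over the same vectors `e_{x₀} - f`, and the form of `A_[Λ]` is dominated
by that of `A`. -/
theorem localIntensity_le_alphaLocal (hA : HypothesisH A) (hμ : IsDPP (correlationOp A) μ)
    (hx₀ : x₀ ∉ ξ) {Λ : Finset E} (hx : x₀ ∈ Λ) :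
    localIntensity μ x₀ ξ Λ ≤ alphaLocal A x₀ ξ Λ := by
  refine le_ciInf fun f => ?_
  have hf := f.2
  set g : ℓ²(E, ℂ) := basisVec x₀ - (f : ℓ²(E, ℂ)) with hg
  have hgy : ∀ y, y ≠ x₀ → y ∉ (Λ : Set E) ∩ ξ → g y = 0 := by
    intro y h1 h2
    rw [hg, lp.coeFn_sub, Pi.sub_apply, basisVec_apply_ne h1,
      apply_eq_zero_of_mem_localFunctions hf h2, sub_zero]
  have hext : extendZero (fun x : Λ => g (x : E)) = g := by
    refine extendZero_restriction fun y hy => hgy y ?_ fun h => hy h.1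
    rintro rfl
    exact hy hx
  have h1 := (exists_localIntensity_vector hA hμ hx₀ hx).2 (fun x : Λ => g (x : E)) ?_ ?_
  · obtain ⟨h, -, -, h2⟩ := exists_localInteraction_form hA.isPositive (fun x : Λ => g (x : E))
    rw [hext] at h2
    exact h1.trans (Complex.le_def.1 h2).1
  · change g x₀ = 1
    rw [hg, lp.coeFn_sub, Pi.sub_apply, basisVec_apply_self,
      apply_eq_zero_of_mem_localFunctions hf fun h => hx₀ h.2, sub_zero]
  · intro x hxi
    exact hgy x (fun h => hxi (Or.inl h)) fun h => hxi (Or.inr h.2)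

theorem exists_tendsto_alphaLocal_localIntensity (hA : HypothesisH A)
    (hμ : IsDPP (correlationOp A) μ) (hx₀ : x₀ ∉ ξ) :
    ∃ α : ℝ, Tendsto (fun Λ : Finset E => alphaLocal A x₀ ξ Λ) atTop (𝓝 α) ∧
      Tendsto (fun Λ : Finset E => localIntensity μ x₀ ξ Λ) atTop (𝓝 α) := by
  classical
  obtain ⟨H, _, _, _, T, hT, -⟩ := hA.exists_factorization
  have hnorm : ∀ f, normMinusSq A f = ‖T f‖ ^ 2 := by
    intro f
    rw [normMinusSq, ← hT, inner_self_eq_ofReal, Complex.ofReal_re]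
  let V : Submodule ℂ H := ((localFunctions ξ).map (T : ℓ²(E, ℂ) →ₗ[ℂ] H)).topologicalClosure
  set p : H := T (basisVec x₀) - V.starProjection (T (basisVec x₀)) with hp
  have hpV : ∀ z ∈ V, ⟪p, z⟫_ℂ = 0 := fun z hz =>
    (Submodule.mem_orthogonal' V p).1 (Submodule.sub_starProjection_mem_orthogonal _) z hz
  have hTV : ∀ f ∈ localFunctions ξ, T f ∈ V := fun f hf =>
    Submodule.le_topologicalClosure _ (Submodule.mem_map_of_mem hf)
  have hpe : ⟪p, T (basisVec x₀)⟫_ℂ = ((‖p‖ ^ 2 : ℝ) : ℂ) := by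
    rw [← inner_self_eq_ofReal]
    conv_rhs => rw [hp, inner_sub_right, ← hp]
    rw [hpV _ (Submodule.starProjection_apply_mem _ _), sub_zero]
  -- Expand `0 ≤ ‖p - T (g + h)‖²`, using `⟪p, T g⟫ = ‖p‖²` for every admissible `g`.
  have hlower : ∀ g h : ℓ²(E, ℂ), basisVec x₀ - g ∈ localFunctions ξ →
      ‖p‖ ^ 2 + 2 * (⟪p, T h⟫_ℂ).re ≤ ‖T (g + h)‖ ^ 2 := by
    intro g h hg
    have h1 : ⟪p, T g⟫_ℂ = ((‖p‖ ^ 2 : ℝ) : ℂ) := by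
      have := hpV _ (hTV _ hg)
      rw [map_sub, inner_sub_right, hpe] at this
      exact (sub_eq_zero.1 this).symm
    have h2 := norm_sub_sq (𝕜 := ℂ) p (T (g + h))
    rw [map_add, inner_add_right, h1] at h2
    rw [map_add]
    simp only [RCLike.re_to_complex, Complex.add_re, Complex.ofReal_re] at h2
    nlinarith [sq_nonneg ‖p - (T g + T h)‖]
  have hαlower : ∀ Λ : Finset E, ‖p‖ ^ 2 ≤ alphaLocal A x₀ ξ Λ := by
    intro Λ
    refine le_ciInf fun f => ?_
    have := hlower (basisVec x₀ - f) 0 (by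
      rw [sub_sub_cancel]
      exact localFunctions_mono Set.inter_subset_right f.2)
    rw [hnorm]
    simpa using this
  have hbdd : ∀ Λ : Finset E, BddBelow (Set.range fun f : localFunctions ((Λ : Set E) ∩ ξ) =>
      normMinusSq A (basisVec x₀ - (f : ℓ²(E, ℂ)))) := by
    intro Λ
    refine ⟨0, ?_⟩
    rintro _ ⟨f, rfl⟩
    simp only [hnorm]
    positivity
  have hα : Tendsto (fun Λ : Finset E => alphaLocal A x₀ ξ Λ) atTop (𝓝 (‖p‖ ^ 2)) := by
    rw [tendsto_order]
    refine ⟨fun b hb => Eventually.of_forall fun Λ => hb.trans_le (hαlower Λ), fun b hb => ?_⟩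
    have hcont : Continuous fun z : H => ‖T (basisVec x₀) - z‖ ^ 2 := by fun_prop
    have hmem : V.starProjection (T (basisVec x₀)) ∈
        closure (((localFunctions ξ).map (T : ℓ²(E, ℂ) →ₗ[ℂ] H) : Submodule ℂ H) : Set H) :=
      Submodule.starProjection_apply_mem V _
    obtain ⟨z, hz, hzmem⟩ := mem_closure_iff.1 hmem _ (isOpen_lt hcont continuous_const)
      (show ‖T (basisVec x₀) - V.starProjection (T (basisVec x₀))‖ ^ 2 < b from hb)
    obtain ⟨f, hf, rfl⟩ := hzmem
    obtain ⟨Λ₀, hΛ₀⟩ := exists_finset_mem_localFunctions hf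
    filter_upwards [eventually_ge_atTop Λ₀] with Λ hΛ
    have hfΛ : f ∈ localFunctions ((Λ : Set E) ∩ ξ) :=
      localFunctions_mono (Set.inter_subset_inter_left _ (by exact_mod_cast hΛ)) hΛ₀
    refine (ciInf_le (hbdd Λ) ⟨f, hfΛ⟩).trans_lt ?_
    rw [hnorm, map_sub]
    exact hz
  refine ⟨‖p‖ ^ 2, hα, ?_⟩
  -- The adjoint moves `⟪p, T h⟫` to `ℓ²(E)`, where only the tail of the fixed vector `q` sees an
  -- `h` vanishing on `Λ`.
  set q : ℓ²(E, ℂ) := ContinuousLinearMap.adjoint T p with hq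
  have htail := tendsto_norm_sub_sum_single q
  have hlim : Tendsto (fun Λ : Finset E => ‖p‖ ^ 2 - ‖q - ∑ x ∈ Λ, lp.single 2 x (q x)‖ ^ 2) atTop
      (𝓝 (‖p‖ ^ 2)) := by
    simpa using (htail.pow 2).const_sub (‖p‖ ^ 2)
  refine tendsto_of_tendsto_of_tendsto_of_le_of_le' hlim hα ?_ ?_
  · filter_upwards [eventually_ge_atTop {x₀}] with Λ hΛ
    have hx : x₀ ∈ Λ := hΛ (Finset.mem_singleton_self x₀)
    obtain ⟨⟨v, hv, hvr⟩, -⟩ := exists_localIntensity_vector hA hμ hx₀ hx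
    obtain ⟨h, h0, hform, -⟩ := exists_localInteraction_form hA.isPositive v
    rw [hvr, ← hT, inner_self_eq_ofReal, inner_self_eq_ofReal, ← Complex.ofReal_add,
      Complex.ofReal_inj] at hform
    have h1 := hlower _ h (localFunctions_mono Set.inter_subset_right hv)
    rw [← ContinuousLinearMap.adjoint_inner_left, ← hq, inner_eq_inner_tail q h h0] at h1
    have h2 := (abs_le.1 (Complex.abs_re_le_norm
      ⟪q - ∑ x ∈ Λ, lp.single 2 x (q x), h⟫_ℂ)).1
    have h3 := norm_inner_le_norm (𝕜 := ℂ) (q - ∑ x ∈ Λ, lp.single 2 x (q x)) h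
    rw [hform]
    -- With `t` the tail norm, `‖h‖² - 2 t ‖h‖ ≥ -t²`: the penalty `‖h‖²` absorbs the cross term, so
    -- no bound on `h` uniform in `Λ` is needed.
    nlinarith [sq_nonneg (‖q - ∑ x ∈ Λ, lp.single 2 x (q x)‖ - ‖h‖)]
  · filter_upwards [eventually_ge_atTop {x₀}] with Λ hΛ
    exact localIntensity_le_alphaLocal hA hμ hx₀ (hΛ (Finset.mem_singleton_self x₀))

end Intensity

end DPP

end

theorem theorem2p4 {E : Type u} [Countable E]
    (A : ℓ²(E, ℂ) →L[ℂ] ℓ²(E, ℂ)) (hA : DPP.HypothesisH A)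
    (μ : Measure (Set E)) (hμ : DPP.IsDPP (DPP.correlationOp A) μ)
    (x₀ : E) (ξ : Set E) (hx₀ : x₀ ∉ ξ) :
    (∀ Λ : Finset E, 0 < DPP.marginal μ Λ (ξ ∩ (Λ : Set E))) ∧
    (∀ Λ : Finset E, DPP.LocallyInvertible (DPP.correlationOp A) Λ) ∧
    (∀ Λ : Finset E,
      DPP.minor (DPP.localInteraction (DPP.correlationOp A) Λ) ξ ≠ 0) ∧
    (∀ Λ : Finset E, x₀ ∈ Λ →
      (DPP.localIntensity μ x₀ ξ Λ : ℂ) =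
        DPP.minor (DPP.localInteraction (DPP.correlationOp A) Λ) (insert x₀ ξ) /
          DPP.minor (DPP.localInteraction (DPP.correlationOp A) Λ) ξ) ∧
    ∃ α : ℝ,
      Tendsto (fun Λ : Finset E => DPP.alphaLocal A x₀ ξ Λ) atTop (𝓝 α) ∧
      Tendsto (fun Λ : Finset E => DPP.localIntensity μ x₀ ξ Λ) atTop (𝓝 α) :=
  ⟨fun Λ => DPP.marginal_pos hA hμ Λ ξ,
    fun Λ => DPP.locallyInvertible_correlationOp hA.isPositive Λ,
    fun Λ => hA.minor_localInteraction_ne_zero Λ ξ,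
    fun _ hx => DPP.localIntensity_eq hA hμ hx,
    DPP.exists_tendsto_alphaLocal_localIntensity hA hμ hx₀⟩
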